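/- Let $n,m,k\ge 0$ be integers with $k\le m$. A \emph{contact set} $C$ of $m$ contacts on $\mathbb R^n$, the first $k$ of which are frictional, consists of a row vector $J_{n,i}\in\mathbb R^{1\times n}$ for each $i\in\{1,\dots,m\}$, and of a matrix $J_{t,j}\in\mathbb R^{2\times n}$ and a friction coefficient $\mu_j>0$ for each $j\in\{1,\dots,k\}$ (velocity coordinates being chosen so that the mass matrix is the identity). For a vector $x$ in a Euclidean space let $\mathrm{Unit}(x)=\{x/\|x\|_2\}$ if $x\ne 0$, and let $\mathrm{Unit}(0)$ be the closed unit ball. Put $$A_i=\{v\in\mathbb R^n: J_{n,i}v<0\},\qquad A_C=\bigcup_{i=1}^m A_i,\qquad I_C=\operatorname{int}(\mathbb R^n\setminus A_C),$$ $$F_i(v)=J_{n,i}^T-\mu_iJ_{t,i}^T\,\mathrm{Unit}(J_{t,i}v)\ \ (i\le k),\qquad F_i(v)=\{J_{n,i}^T\}\ \ (i>k),$$ $$F_C(v)=\operatorname{conv}\{f : f\in F_i(v)\text{ for some } i\in\{1,\dots,m\}\text{ with } v\in\overline{A_i}\},$$ $$D_C(v)=\begin{cases}\{0\}& v\in I_C,\\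 F_C(v)& v\in A_C,\\ \operatorname{conv}(\{0\}\cup F_C(v))&\text{otherwise.}\end{cases}$$ For a compact interval $I=[a,b]$, $a\le b$, let $\mathrm{SOL}(D_C;I)$ be the set of absolutely continuous functions $v:I\to\mathbb R^n$ with $\dot v(s)\in D_C(v(s))$ for almost every $s\in I$, and for $v_0\in\mathbb R^n$ let $\mathrm{IVP}(D_C,v_0;I)$ be the set of those $v\in\mathrm{SOL}(D_C;I)$ with $v(a)=v_0$. \textbf{Lemma.} For every contact set $C$, every $v_0\in\mathbb R^n$ and every compact interval $I=[a,b]$, the sets $\mathrm{SOL}(D_C;I)$ and $\mathrm{IVP}(D_C,v_0;I)$ are non-empty and closed under uniform convergence: if $v_1,v_2,\dots$ belong to one of these sets and $v_j\to v$ uniformly on $I$, then $v$ belongs to the same set. -/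

import Mathlib

namespace MultiContact

/-- The space `ℝⁿ` of generalized velocities, with its Euclidean norm. -/
abbrev Velocity (n : ℕ) : Type := EuclideanSpace ℝ (Fin n)

/-- The set-valued unit direction function: `{v / ‖v‖}` for `v ≠ 0`, and the closed unit ball
for `v = 0`. -/
noncomputable def unitDir {n : ℕ} (v : Velocity n) : Set (Velocity n) :=
  {u | (v ≠ 0 ∧ u = ‖v‖⁻¹ • v) ∨ (v = 0 ∧ u ∈ Metric.closedBall (0 : Velocity n) 1)}

/-- A set of `m` contacts on a system with `n` velocity coordinates, the first `k ≤ m` contacts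
being frictional. The Jacobians are expressed in the velocity coordinates in which the
(constant) mass matrix is the identity. -/
structure ContactSet (n m k : ℕ) where
  /-- there are at most as many frictional contacts as contacts -/
  frictional_le : k ≤ m
  /-- row `i` projects a velocity onto the normal of contact `i` -/
  Jn : Matrix (Fin m) (Fin n) ℝ
  /-- `Jt j` consists of the two rows that project a velocity onto the tangent plane of the
  frictional contact `j` -/
  Jt : Fin k → Matrix (Fin 2) (Fin n) ℝ
  /-- friction coefficients of the frictional contacts -/
  μ : Fin k → ℝ
  μ_pos : ∀ j, 0 < μ j

namespace ContactSet

variable {n m k : ℕ} (C : ContactSet n m k)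

/-- The normal velocity `Jₙ v` at contact `i`. -/
def normalVel (i : Fin m) (v : Velocity n) : ℝ := (C.Jn.mulVec v.ofLp) i

/-- The tangential velocity `Jₜ v` at the frictional contact `j`. -/
def tangentVel (j : Fin k) (v : Velocity n) : Velocity 2 :=
  WithLp.toLp 2 ((C.Jt j).mulVec v.ofLp)

/-- The vector `Jₙᵀ` of contact `i`. -/
def normalForce (i : Fin m) : Velocity n := WithLp.toLp 2 (C.Jn i)

/-- The vector `Jₜᵀ u` for the frictional contact `j`. -/
def tangentForce (j : Fin k) (u : Velocity 2) : Velocity n :=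
  WithLp.toLp 2 ((C.Jt j).transpose.mulVec u.ofLp)

/-- The set of velocities that penetrate at contact `i`. -/
def contactActiveSet (i : Fin m) : Set (Velocity n) := {v | C.normalVel i v < 0}

/-- The set of velocities that penetrate at some contact. -/
def activeSet : Set (Velocity n) := {v | ∃ i, C.normalVel i v < 0}

/-- The set of separating velocities. -/
def inactiveSet : Set (Velocity n) := interior C.activeSetᶜ

/-- The force set of the single contact `i`: `Jₙᵀ - μ Jₜᵀ Unit(Jₜ v)` if the contact is
frictional, and `{Jₙᵀ}` if it is frictionless. -/
def contactForce (i : Fin m) (v : Velocity n) : Set (Velocity n) :=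
  if h : (i : ℕ) < k then
    {f | ∃ u ∈ unitDir (C.tangentVel ⟨i, h⟩ v),
      f = C.normalForce i - C.μ ⟨i, h⟩ • C.tangentForce ⟨i, h⟩ u}
  else {C.normalForce i}

/-- The net force set: the convex hull of the forces of those contacts `i` for which `v` lies in
the closure of the active set of contact `i`. -/
def netForce (v : Velocity n) : Set (Velocity n) :=
  convexHull ℝ {f | ∃ i, v ∈ closure (C.contactActiveSet i) ∧ f ∈ C.contactForce i v}

open Classical in
/-- The right-hand side of the multi-contact differential inclusion. -/
noncomputable def derivMap (v : Velocity n) : Set (Velocity n) :=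
  if v ∈ C.inactiveSet then {0}
  else if v ∈ C.activeSet then C.netForce v
  else convexHull ℝ ({0} ∪ C.netForce v)

end ContactSet

/-- Solutions on `[a, b]` of the differential inclusion `v' ∈ D v`: absolutely continuous
functions whose derivative exists and satisfies the inclusion almost everywhere on `[a, b]`.
Functions on `[a, b]` are represented by functions on `ℝ`; only the values on `[a, b]` matter. -/
def solutionSet {n : ℕ} (D : Velocity n → Set (Velocity n)) (a b : ℝ) :
    Set (ℝ → Velocity n) :=
  {v | AbsolutelyContinuousOnInterval v a b ∧
    ∀ᵐ t ∂(MeasureTheory.volume.restrict (Set.Icc a b)),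
      ∃ w ∈ D (v t), HasDerivWithinAt v w (Set.Icc a b) t}

/-- Solutions on `[a, b]` of the initial value problem `v' ∈ D v`, `v a = v₀`. -/
def ivpSet {n : ℕ} (D : Velocity n → Set (Velocity n)) (v₀ : Velocity n) (a b : ℝ) :
    Set (ℝ → Velocity n) :=
  {v | v ∈ solutionSet D a b ∧ v a = v₀}

/-- A set of functions is closed under uniform convergence on `[a, b]`: it contains every limit,
uniform on `[a, b]`, of a sequence of its elements. -/
def ClosedUnderUniformConvergence {n : ℕ} (S : Set (ℝ → Velocity n)) (a b : ℝ) : Prop :=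
  ∀ (u : ℕ → ℝ → Velocity n) (v : ℝ → Velocity n), (∀ j, u j ∈ S) →
    TendstoUniformlyOn u v Filter.atTop (Set.Icc a b) → v ∈ S

end MultiContact

namespace MultiContact

open Filter Topology Set

/-! `C.derivMap` is bounded, with nonempty compact convex values, and upper semicontinuous against
half-spaces; the theorem holds for every such right-hand side. By Hahn–Banach, a Lipschitz curve is
a solution as soon as its short forward increments obey each half-space bound valid near the current
point (`mem_solutionSet_of_increment_le`). These are non-strict inequalities between values of the
curve, so they survive pointwise limits, and no convergence of derivatives is needed. Applied to
limits of solutions, the criterion gives closedness; applied to limits of Euler iterates, it gives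
existence. -/

/-- In a finite-dimensional space the convex hull of a compact set is compact. -/
theorem isCompact_convexHull_of_isCompact {E : Type*} [NormedAddCommGroup E] [NormedSpace ℝ E]
    [FiniteDimensional ℝ E] {s : Set E} (hs : IsCompact s) : IsCompact (convexHull ℝ s) := by
  let T : ℕ → Set E := fun N =>
    (fun p : (Fin N → ℝ) × (Fin N → E) => ∑ i, p.1 i • p.2 i) ''
      (stdSimplex ℝ (Fin N) ×ˢ Set.pi univ fun _ => s)
  -- Carathéodory: `finrank + 1` points suffice, so the hull is a finite union of continuous images
  -- of compact sets.
  have hT : convexHull ℝ s = ⋃ N ∈ Finset.range (Module.finrank ℝ E + 2), T N := by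
    apply Subset.antisymm
    · intro x hx
      obtain ⟨ι, _, z, w, hz, hind, hw, hw1, hx⟩ := eq_pos_convex_span_of_mem_convexHull hx
      have hcard : Fintype.card ι ≤ Module.finrank ℝ E + 1 :=
        hind.card_le_finrank_succ.trans (by gcongr; exact Submodule.finrank_le _)
      let e := Fintype.equivFin ι
      refine mem_biUnion (x := Fintype.card ι) (by simp; omega)
        ⟨(w ∘ e.symm, z ∘ e.symm), ⟨⟨fun i => (hw _).le, ?_⟩, fun i _ => hz ⟨_, rfl⟩⟩, ?_⟩
      · rw [← hw1]; exact e.symm.sum_comp w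
      · rw [← hx]; exact e.symm.sum_comp fun i => w i • z i
    · refine iUnion₂_subset fun N _ => ?_
      rintro _ ⟨⟨w, z⟩, ⟨hw, hz⟩, rfl⟩
      exact (convex_convexHull ℝ s).sum_mem (fun i _ => hw.1 i) hw.2
        fun i _ => subset_convexHull ℝ s (hz i (mem_univ i))
  rw [hT]
  refine (Finset.range _).isCompact_biUnion fun N _ => ?_
  exact ((isCompact_stdSimplex ℝ (Fin N)).prod (isCompact_univ_pi fun _ => hs)).image (by fun_prop)

/-! ### Half-space criterion and closedness of solution sets -/

variable {n : ℕ}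

/-- Upper semicontinuity of a set-valued map, tested on open half-spaces. -/
def HalfSpaceUSC (D : Velocity n → Set (Velocity n)) : Prop :=
  ∀ (x : Velocity n) (f : StrongDual ℝ (Velocity n)) (c : ℝ), (∀ w ∈ D x, f w < c) →
    ∀ᶠ y in 𝓝 x, ∀ w ∈ D y, f w < c

/-- A Lipschitz function whose forward increments obey every local half-space bound on `D`
solves the differential inclusion `v' ∈ D v`. -/
theorem mem_solutionSet_of_increment_le {D : Velocity n → Set (Velocity n)}
    (husc : HalfSpaceUSC D) (hconv : ∀ x, Convex ℝ (D x)) (hclosed : ∀ x, IsClosed (D x))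
    {a b : ℝ} (hab : a ≤ b) {v : ℝ → Velocity n} {K : NNReal}
    (hv : LipschitzOnWith K v (Icc a b))
    (hinc : ∀ t₀ ∈ Ioo a b, ∀ (f : StrongDual ℝ (Velocity n)) (c : ℝ),
      (∀ᶠ y in 𝓝 (v t₀), ∀ w ∈ D y, f w < c) →
      ∀ᶠ t in 𝓝[>] t₀, f (v t) - f (v t₀) ≤ c * (t - t₀)) :
    v ∈ solutionSet D a b := by
  refine ⟨(uIcc_of_le hab ▸ hv).absolutelyContinuousOnInterval, ?_⟩
  rw [← MeasureTheory.Measure.restrict_congr_set MeasureTheory.Ioo_ae_eq_Icc]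
  have hd := hv.ae_differentiableWithinAt_of_mem_real
  filter_upwards [MeasureTheory.ae_restrict_of_ae hd,
    MeasureTheory.ae_restrict_mem measurableSet_Ioo] with t₀ hdt ht₀
  have hder := (hdt (Ioo_subset_Icc_self ht₀)).hasDerivWithinAt
  refine ⟨_, ?_, hder⟩
  by_contra hnot
  -- The separating functional is below `c` on `D (v t₀)` but above `c` at the derivative;
  -- right-hand slopes at most `c` contradict this.
  obtain ⟨f, c, hc, hlt⟩ := geometric_hahn_banach_closed_point (hconv _) (hclosed _) hnot
  have hderiv : HasDerivAt v (derivWithin v (Icc a b) t₀) t₀ :=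
    hder.hasDerivAt (Icc_mem_nhds ht₀.1 ht₀.2)
  have hf : HasDerivAt (fun t => f (v t)) (f (derivWithin v (Icc a b) t₀)) t₀ :=
    f.hasFDerivAt.comp_hasDerivAt t₀ hderiv
  have hslope := (hasDerivAt_iff_tendsto_slope.1 hf).mono_left
    (nhdsWithin_mono (s := Ioi t₀) t₀ fun t ht => ne_of_gt (mem_Ioi.1 ht))
  refine hlt.not_ge (le_of_tendsto hslope ?_)
  filter_upwards [hinc t₀ ht₀ f c (husc _ f c hc), self_mem_nhdsWithin] with t ht htt
  rw [slope_def_field, div_le_iff₀ (sub_pos.2 htt)]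
  exact ht

/-- Solutions obey half-space bounds on their increments. -/
theorem increment_le_of_mem_solutionSet {D : Velocity n → Set (Velocity n)} {a b : ℝ}
    {u : ℝ → Velocity n} (hu : u ∈ solutionSet D a b) {s t : ℝ} (has : a ≤ s) (hst : s ≤ t)
    (htb : t ≤ b) (f : StrongDual ℝ (Velocity n)) (c : ℝ)
    (hc : ∀ r ∈ Icc s t, ∀ w ∈ D (u r), f w ≤ c) :
    f (u t) - f (u s) ≤ c * (t - s) := by
  have hac : AbsolutelyContinuousOnInterval (fun r => f (u r)) s t := by
    have h1 : AbsolutelyContinuousOnInterval u s t := hu.1.mono (by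
      rw [uIcc_of_le hst, uIcc_of_le (has.trans (hst.trans htb))]
      exact Icc_subset_Icc has htb)
    rw [absolutelyContinuousOnInterval_iff] at h1 ⊢
    intro ε hε
    obtain ⟨δ, hδ, h⟩ := h1 (ε / (‖f‖ + 1)) (by positivity)
    refine ⟨δ, hδ, fun E hE hlt => ?_⟩
    have := h E hE hlt
    rw [lt_div_iff₀ (by positivity), Finset.sum_mul] at this
    refine lt_of_le_of_lt (Finset.sum_le_sum fun i _ => ?_) this
    rw [Real.dist_eq, ← map_sub, dist_eq_norm, mul_comm, ← Real.norm_eq_abs]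
    exact (f.le_opNorm _).trans (by gcongr; linarith)
  rw [← hac.integral_deriv_eq_sub]
  calc ∫ r in s..t, deriv (fun r => f (u r)) r ≤ ∫ _ in s..t, c := by
        refine intervalIntegral.integral_mono_ae_restrict hst hac.intervalIntegrable_deriv
          intervalIntegrable_const ?_
        rw [← MeasureTheory.Measure.restrict_congr_set MeasureTheory.Ioo_ae_eq_Icc]
        have h2 := hu.2
        rw [Filter.EventuallyLE]
        filter_upwards [MeasureTheory.ae_restrict_of_ae_restrict_of_subset
          (Ioo_subset_Icc_self.trans (Icc_subset_Icc has htb)) h2,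
          MeasureTheory.ae_restrict_mem measurableSet_Ioo] with r ⟨w, hw, hd⟩ hr
        have hd' : HasDerivAt u w r :=
          hd.hasDerivAt (Icc_mem_nhds (has.trans_lt hr.1) (hr.2.trans_le htb))
        have hf : HasDerivAt (fun t => f (u t)) (f w) r := f.hasFDerivAt.comp_hasDerivAt r hd'
        rw [hf.deriv]
        exact hc r (Ioo_subset_Icc_self hr) w hw
    _ = c * (t - s) := by simp [mul_comm]

/-- Solutions of an inclusion with right-hand side bounded by `M` are `M`-Lipschitz. -/
theorem lipschitzOnWith_of_mem_solutionSet {D : Velocity n → Set (Velocity n)} {a b : ℝ}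
    {M : NNReal} (hM : ∀ x, ∀ w ∈ D x, ‖w‖ ≤ M) {u : ℝ → Velocity n}
    (hu : u ∈ solutionSet D a b) : LipschitzOnWith M u (Icc a b) := by
  have key : ∀ s ∈ Icc a b, ∀ t ∈ Icc a b, s ≤ t → dist (u s) (u t) ≤ M * dist s t := by
    intro s hs t ht hst
    -- A norming functional turns scalar increment bounds into a norm bound.
    obtain ⟨f, hf1, hf⟩ := exists_dual_vector'' ℝ (u t - u s)
    have := increment_le_of_mem_solutionSet hu hs.1 hst ht.2 f M fun r _ w hw =>
      (le_abs_self _).trans <| (f.le_opNorm w).trans <|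
        (mul_le_of_le_one_left (norm_nonneg w) hf1).trans (hM _ w hw)
    rw [← map_sub, hf] at this
    rw [dist_comm, dist_eq_norm, dist_comm s, Real.dist_eq, abs_of_nonneg (sub_nonneg.2 hst)]
    simpa using this
  refine LipschitzOnWith.of_dist_le_mul fun s hs t ht => ?_
  rcases le_total s t with h | h
  · exact key s hs t ht h
  · rw [dist_comm, dist_comm s]; exact key t ht s hs h

/-- The solution set of an inclusion with bounded, closed convex valued, upper semicontinuous
right-hand side is closed under uniform convergence. -/
theorem closedUnderUniformConvergence_solutionSet {D : Velocity n → Set (Velocity n)}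
    (husc : HalfSpaceUSC D) (hconv : ∀ x, Convex ℝ (D x)) (hclosed : ∀ x, IsClosed (D x))
    {M : NNReal} (hM : ∀ x, ∀ w ∈ D x, ‖w‖ ≤ M) {a b : ℝ} (hab : a ≤ b) :
    ClosedUnderUniformConvergence (solutionSet D a b) a b := by
  intro u v hu huv
  have hlip : LipschitzOnWith M v (Icc a b) := by
    refine LipschitzOnWith.of_dist_le_mul fun s hs t ht => ?_
    exact le_of_tendsto ((huv.tendsto_at hs).dist (huv.tendsto_at ht)) (Eventually.of_forall
      fun j => (lipschitzOnWith_of_mem_solutionSet hM (hu j)).dist_le_mul s hs t ht)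
  refine mem_solutionSet_of_increment_le husc hconv hclosed hab hlip fun t₀ ht₀ f c hc => ?_
  obtain ⟨δ, hδ, hball⟩ := Metric.eventually_nhds_iff_ball.1 hc
  have hcont : ContinuousAt v t₀ := hlip.continuousOn.continuousAt (Icc_mem_nhds ht₀.1 ht₀.2)
  -- One `δ / 2` pays for the motion of `v` near `t₀`, the other for the uniform distance from `u j`
  -- to `v`.
  obtain ⟨η, hη, hclose⟩ := Metric.continuousAt_iff.1 hcont (δ / 2) (half_pos hδ)
  filter_upwards [Ioo_mem_nhdsGT (lt_min (lt_add_of_pos_right t₀ hη) ht₀.2)] with t ht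
  have htη : t < t₀ + η := ht.2.trans_le (min_le_left _ _)
  have htb : t ≤ b := ht.2.le.trans (min_le_right _ _)
  have hmem : ∀ r ∈ Icc t₀ t, r ∈ Icc a b := fun r hr => ⟨ht₀.1.le.trans hr.1, hr.2.trans htb⟩
  have hlim : Tendsto (fun j => f (u j t) - f (u j t₀)) atTop (𝓝 (f (v t) - f (v t₀))) :=
    ((f.continuous.tendsto _).comp (huv.tendsto_at (hmem t ⟨ht.1.le, le_rfl⟩))).sub
      ((f.continuous.tendsto _).comp (huv.tendsto_at (hmem t₀ ⟨le_rfl, ht.1.le⟩)))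
  refine le_of_tendsto hlim ?_
  filter_upwards [Metric.tendstoUniformlyOn_iff.1 huv (δ / 2) (half_pos hδ)] with j hj
  refine increment_le_of_mem_solutionSet (hu j) ht₀.1.le ht.1.le htb f c fun r hr w hw => ?_
  refine (hball (u j r) ?_ w hw).le
  have h1 := hj r (hmem r hr)
  have h2 : dist (v r) (v t₀) < δ / 2 := hclose (by
    rw [Real.dist_eq, abs_of_nonneg (sub_nonneg.2 hr.1)]; linarith [hr.2])
  rw [Metric.mem_ball]
  linarith [dist_triangle_left (u j r) (v t₀) (v r)]

/-! ### Existence by Euler's method -/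

/-- The explicit Euler iterates with step `h` for the vector field `g`. -/
noncomputable def eulerIter (g : Velocity n → Velocity n) (h : ℝ) (x₀ : Velocity n) :
    ℕ → Velocity n
  | 0 => x₀
  | l + 1 => eulerIter g h x₀ l + h • g (eulerIter g h x₀ l)

/-- Discrete counterpart of `increment_le_of_mem_solutionSet`, by telescoping. -/
theorem eulerIter_increment_le (g : Velocity n → Velocity n) {h : ℝ} (hh : 0 ≤ h)
    (x₀ : Velocity n) (f : StrongDual ℝ (Velocity n)) (c : ℝ) {i j : ℕ} (hij : i ≤ j)
    (hc : ∀ l, i ≤ l → l < j → f (g (eulerIter g h x₀ l)) ≤ c) :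
    f (eulerIter g h x₀ j) - f (eulerIter g h x₀ i) ≤ c * (h * ((j : ℝ) - i)) := by
  induction j, hij using Nat.le_induction with
  | base => simp
  | succ j hij ih =>
    have h1 := ih fun l h1 h2 => hc l h1 (h2.trans j.lt_succ_self)
    have h2 := mul_le_mul_of_nonneg_left (hc j hij j.lt_succ_self) hh
    simp only [eulerIter, map_add, map_smul, smul_eq_mul]
    push_cast
    linarith

theorem norm_eulerIter_sub_le {g : Velocity n → Velocity n} {M : NNReal} (hM : ∀ x, ‖g x‖ ≤ M)
    {h : ℝ} (hh : 0 ≤ h) (x₀ : Velocity n) {i j : ℕ} (hij : i ≤ j) :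
    ‖eulerIter g h x₀ j - eulerIter g h x₀ i‖ ≤ M * (h * ((j : ℝ) - i)) := by
  obtain ⟨f, hf1, hf⟩ := exists_dual_vector'' ℝ (eulerIter g h x₀ j - eulerIter g h x₀ i)
  have := eulerIter_increment_le g hh x₀ f M hij fun l _ _ =>
    (le_abs_self _).trans <| (f.le_opNorm _).trans <|
      (mul_le_of_le_one_left (norm_nonneg _) hf1).trans (hM _)
  rw [← map_sub, hf] at this
  simpa using this

/-- Both rounding errors lie in `[0, h)`, so their difference is at most `h`, not `2 * h`. -/
theorem abs_mul_floor_sub_le {h : ℝ} (hh : 0 < h) {s t : ℝ} (hs : 0 ≤ s) (ht : 0 ≤ t) :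
    |h * ((⌊t / h⌋₊ : ℝ) - ⌊s / h⌋₊) - (t - s)| ≤ h := by
  have h1 := Nat.floor_le (div_nonneg hs hh.le)
  have h2 := Nat.floor_le (div_nonneg ht hh.le)
  have h3 := Nat.lt_floor_add_one (s / h)
  have h4 := Nat.lt_floor_add_one (t / h)
  rw [le_div_iff₀ hh] at h1 h2
  rw [div_lt_iff₀ hh] at h3 h4
  rw [abs_le]
  constructor <;> linarith

/-- Existence of solutions of the initial value problem for an inclusion with bounded, nonempty,
closed convex valued, upper semicontinuous right-hand side. -/
theorem ivpSet_nonempty {D : Velocity n → Set (Velocity n)}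
    (husc : HalfSpaceUSC D) (hconv : ∀ x, Convex ℝ (D x)) (hclosed : ∀ x, IsClosed (D x))
    (hne : ∀ x, (D x).Nonempty) {M : NNReal} (hM : ∀ x, ∀ w ∈ D x, ‖w‖ ≤ M)
    (v₀ : Velocity n) {a b : ℝ} (hab : a ≤ b) : (ivpSet D v₀ a b).Nonempty := by
  choose g hg using hne
  have hgM : ∀ x, ‖g x‖ ≤ M := fun x => hM x _ (hg x)
  let h : ℕ → ℝ := fun N => 1 / ((N : ℝ) + 1)
  have hpos : ∀ N, 0 < h N := fun N => Nat.one_div_pos_of_nat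
  -- Limits along one free ultrafilter exist for all times at once, replacing Arzelà–Ascoli and
  -- subsequences.
  let F : Ultrafilter ℕ := hyperfilter ℕ
  have hh0 : Tendsto h F (𝓝 0) :=
    tendsto_one_div_add_atTop_nhds_zero_nat.mono_left Nat.hyperfilter_le_atTop
  let idx : ℕ → ℝ → ℕ := fun N t => ⌊(t - a) / h N⌋₊
  -- Piecewise constant, without interpolation: the jumps disappear in the limit.
  let u : ℕ → ℝ → Velocity n := fun N t => eulerIter g (h N) v₀ (idx N t)
  have hidx : ∀ N s t, s ≤ t → idx N s ≤ idx N t := fun N s t hst =>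
    Nat.floor_le_floor (div_le_div_of_nonneg_right (by linarith) (hpos N).le)
  have hfloor : ∀ N s t, a ≤ s → a ≤ t →
      |h N * ((idx N t : ℝ) - idx N s) - (t - s)| ≤ h N := fun N s t hs ht => by
    simpa using abs_mul_floor_sub_le (hpos N) (sub_nonneg.2 hs) (sub_nonneg.2 ht)
  have hstep : ∀ s t, a ≤ s → a ≤ t →
      Tendsto (fun N => h N * ((idx N t : ℝ) - idx N s)) F (𝓝 (t - s)) := fun s t hs ht => by
    rw [tendsto_iff_dist_tendsto_zero]
    exact squeeze_zero (fun _ => dist_nonneg) (fun N => hfloor N s t hs ht) hh0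
  have hu : ∀ N s t, s ≤ t → ‖u N t - u N s‖ ≤ M * (h N * ((idx N t : ℝ) - idx N s)) :=
    fun N s t hst => norm_eulerIter_sub_le hgM (hpos N).le v₀ (hidx N s t hst)
  have hua : ∀ N, u N a = v₀ := fun N => by simp [u, idx, eulerIter]
  have hlim : ∀ t, ∃ y, a ≤ t → Tendsto (fun N => u N t) F (𝓝 y) := by
    intro t
    by_cases hat : a ≤ t
    · have hK : ∀ N, u N t ∈ Metric.closedBall v₀ (M * (t - a + 1)) := by
        intro N
        have h1 := hu N a t hat
        rw [hua] at h1
        rw [mem_closedBall_iff_norm]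
        refine h1.trans (mul_le_mul_of_nonneg_left ?_ M.2)
        have h2 := (abs_le.1 (hfloor N a t le_rfl hat)).2
        have h3 : h N ≤ 1 := by
          have : (0 : ℝ) ≤ N := N.cast_nonneg
          simp only [h]; rw [div_le_one (by positivity)]; linarith
        linarith
      obtain ⟨y, -, hy⟩ := (isCompact_closedBall v₀ (M * (t - a + 1))).ultrafilter_le_nhds
        (F.map fun N => u N t) (le_principal_iff.2 (Filter.mem_map.2 (univ_mem' hK)))
      exact ⟨y, fun _ => hy⟩
    · exact ⟨0, fun h => absurd h hat⟩
  choose v hv using hlim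
  have hlip : LipschitzOnWith M v (Icc a b) := by
    have key : ∀ s ∈ Icc a b, ∀ t ∈ Icc a b, s ≤ t → dist (v t) (v s) ≤ M * dist t s := by
      intro s hs t ht hst
      rw [dist_eq_norm, Real.dist_eq, abs_of_nonneg (sub_nonneg.2 hst)]
      exact le_of_tendsto_of_tendsto' ((hv t ht.1).sub (hv s hs.1)).norm
        ((hstep s t hs.1 ht.1).const_mul (M : ℝ)) fun N => hu N s t hst
    refine LipschitzOnWith.of_dist_le_mul fun s hs t ht => ?_
    rcases le_total s t with hst | hst
    · rw [dist_comm, dist_comm s]; exact key s hs t ht hst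
    · exact key t ht s hs hst
  refine ⟨v, mem_solutionSet_of_increment_le husc hconv hclosed hab hlip ?_, ?_⟩
  · intro t₀ ht₀ f c hc
    obtain ⟨δ, hδ, hball⟩ := Metric.eventually_nhds_iff_ball.1 hc
    -- Keeps the drift `M * (t - t₀)` below `δ / 2`; the `+ 1` covers `M = 0`.
    have hη : 0 < δ / 2 / (M + 1) := by positivity
    filter_upwards [Ioo_mem_nhdsGT (lt_add_of_pos_right t₀ hη)] with t ht
    have hat₀ : a ≤ t₀ := ht₀.1.le
    have hat : a ≤ t := hat₀.trans ht.1.le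
    have hMt : M * (t - t₀) < δ / 2 := by
      have h1 : (t - t₀) * (M + 1) < δ / 2 := by
        rw [← lt_div_iff₀ (by positivity)]; linarith [ht.2]
      linarith [ht.1]
    refine le_of_tendsto_of_tendsto
      (((f.continuous.tendsto _).comp (hv t hat)).sub ((f.continuous.tendsto _).comp (hv t₀ hat₀)))
      ((hstep t₀ t hat₀ hat).const_mul c) ?_
    filter_upwards [((hstep t₀ t hat₀ hat).const_mul (M : ℝ)).eventually_lt_const hMt,
      (hv t₀ hat₀).eventually (Metric.ball_mem_nhds _ (half_pos hδ))] with N hN1 hN2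
    -- All iterates used between `t₀` and `t` stay in the `δ`-ball about `v t₀`, where the
    -- half-space bound holds.
    refine eulerIter_increment_le g (hpos N).le v₀ f c (hidx N t₀ t ht.1.le) fun l hl1 hl2 => ?_
    refine (hball _ ?_ _ (hg _)).le
    have h1 := norm_eulerIter_sub_le hgM (hpos N).le v₀ hl1
    have h2 : (M : ℝ) * (h N * ((l : ℝ) - idx N t₀)) ≤
        M * (h N * ((idx N t : ℝ) - idx N t₀)) := by
      have : (l : ℝ) ≤ idx N t := by exact_mod_cast hl2.le
      have := (hpos N).le
      gcongr
    rw [← dist_eq_norm] at h1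
    rw [Metric.mem_ball]
    have h3 : dist (u N t₀) (v t₀) < δ / 2 := hN2
    have h4 := dist_triangle (eulerIter g (h N) v₀ l) (u N t₀) (v t₀)
    have h5 : dist (eulerIter g (h N) v₀ l) (u N t₀) ≤ _ := h1
    linarith
  · refine tendsto_nhds_unique (hv a le_rfl) ?_
    simp only [hua]
    exact tendsto_const_nhds

/-! ### The unit direction map -/

theorem norm_le_one_of_mem_unitDir {n : ℕ} {x u : Velocity n} (hu : u ∈ unitDir x) : ‖u‖ ≤ 1 := by
  rcases hu with ⟨hx, rfl⟩ | ⟨-, hu⟩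
  · rw [norm_smul, norm_inv, norm_norm, inv_mul_cancel₀ (norm_ne_zero_iff.2 hx)]
  · simpa using hu

theorem unitDir_zero {n : ℕ} : unitDir (0 : Velocity n) = Metric.closedBall 0 1 := by
  ext u; simp [unitDir]

theorem unitDir_of_ne_zero {n : ℕ} {x : Velocity n} (hx : x ≠ 0) : unitDir x = {‖x‖⁻¹ • x} := by
  ext u; simp [unitDir, hx]

theorem isCompact_unitDir {n : ℕ} (x : Velocity n) : IsCompact (unitDir x) := by
  rcases eq_or_ne x 0 with rfl | hx
  · rw [unitDir_zero]; exact isCompact_closedBall 0 1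
  · rw [unitDir_of_ne_zero hx]; exact isCompact_singleton

theorem unitDir_nonempty {n : ℕ} (x : Velocity n) : (unitDir x).Nonempty := by
  rcases eq_or_ne x 0 with rfl | hx
  · rw [unitDir_zero]; exact Metric.nonempty_closedBall.2 zero_le_one
  · rw [unitDir_of_ne_zero hx]; exact singleton_nonempty _

/-- At `0` the value is the whole unit ball, which contains every other value; elsewhere the map is
single-valued and continuous. -/
theorem eventually_unitDir_subset {n : ℕ} {x : Velocity n} {U : Set (Velocity n)} (hU : IsOpen U)
    (hx : unitDir x ⊆ U) : ∀ᶠ y in 𝓝 x, unitDir y ⊆ U := by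
  rcases eq_or_ne x 0 with rfl | hx0
  · refine Eventually.of_forall fun y u hu => hx ?_
    rw [unitDir_zero]
    simpa using norm_le_one_of_mem_unitDir hu
  · rw [unitDir_of_ne_zero hx0, singleton_subset_iff] at hx
    have hc : ContinuousAt (fun y : Velocity n => ‖y‖⁻¹ • y) x :=
      (continuousAt_id.norm.inv₀ (norm_ne_zero_iff.2 hx0)).smul continuousAt_id
    filter_upwards [hc.eventually (hU.mem_nhds hx), isOpen_ne.mem_nhds hx0] with y hy hy0
    rw [unitDir_of_ne_zero hy0, singleton_subset_iff]
    exact hy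

/-! ### Regularity of the contact dynamics -/

namespace ContactSet

variable {n m k : ℕ} (C : ContactSet n m k)

theorem continuous_normalVel (i : Fin m) : Continuous (C.normalVel i) := by
  unfold normalVel
  exact (continuous_apply i).comp
    (Continuous.matrix_mulVec continuous_const (PiLp.continuous_ofLp 2 _))

theorem continuous_tangentVel (j : Fin k) : Continuous (C.tangentVel j) := by
  unfold tangentVel
  exact (PiLp.continuous_toLp 2 _).comp
    (Continuous.matrix_mulVec continuous_const (PiLp.continuous_ofLp 2 _))

theorem continuous_tangentForce (j : Fin k) : Continuous (C.tangentForce j) := by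
  unfold tangentForce
  exact (PiLp.continuous_toLp 2 _).comp
    (Continuous.matrix_mulVec continuous_const (PiLp.continuous_ofLp 2 _))

/-- The force of the frictional contact `j` as a function of the friction direction. -/
noncomputable def frictionalForce (i : Fin m) (j : Fin k) (u : Velocity 2) : Velocity n :=
  C.normalForce i - C.μ j • C.tangentForce j u

theorem continuous_frictionalForce (i : Fin m) (j : Fin k) : Continuous (C.frictionalForce i j) :=
  continuous_const.sub ((C.continuous_tangentForce j).const_smul (C.μ j))

theorem contactForce_of_lt (i : Fin m) (h : (i : ℕ) < k) (v : Velocity n) :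
    C.contactForce i v =
      C.frictionalForce i ⟨i, h⟩ '' unitDir (C.tangentVel ⟨i, h⟩ v) := by
  ext f
  simp [contactForce, h, frictionalForce, eq_comm]

theorem contactForce_of_not_lt (i : Fin m) (h : ¬ (i : ℕ) < k) (v : Velocity n) :
    C.contactForce i v = {C.normalForce i} := by
  simp [contactForce, h]

theorem isCompact_contactForce (i : Fin m) (v : Velocity n) : IsCompact (C.contactForce i v) := by
  by_cases h : (i : ℕ) < k
  · rw [C.contactForce_of_lt i h]
    exact (isCompact_unitDir _).image (C.continuous_frictionalForce _ _)
  · rw [C.contactForce_of_not_lt i h]; exact isCompact_singleton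

theorem contactForce_nonempty (i : Fin m) (v : Velocity n) : (C.contactForce i v).Nonempty := by
  by_cases h : (i : ℕ) < k
  · rw [C.contactForce_of_lt i h]; exact (unitDir_nonempty _).image _
  · rw [C.contactForce_of_not_lt i h]; exact singleton_nonempty _

theorem eventually_contactForce_subset (i : Fin m) {v : Velocity n} {U : Set (Velocity n)}
    (hU : IsOpen U) (hv : C.contactForce i v ⊆ U) : ∀ᶠ y in 𝓝 v, C.contactForce i y ⊆ U := by
  by_cases h : (i : ℕ) < k
  · simp only [C.contactForce_of_lt i h, image_subset_iff] at hv ⊢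
    exact (C.continuous_tangentVel _).continuousAt.eventually
      (eventually_unitDir_subset (hU.preimage (C.continuous_frictionalForce _ _)) hv)
  · simp only [C.contactForce_of_not_lt i h] at hv ⊢
    exact Eventually.of_forall fun _ => hv

theorem exists_contactForce_bound (i : Fin m) :
    ∃ M : ℝ, ∀ v, ∀ f ∈ C.contactForce i v, ‖f‖ ≤ M := by
  by_cases h : (i : ℕ) < k
  · obtain ⟨M, hM⟩ := (isCompact_closedBall (0 : Velocity 2) 1).exists_bound_of_continuousOn
      (C.continuous_frictionalForce i ⟨i, h⟩).continuousOn
    refine ⟨M, fun v f hf => ?_⟩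
    rw [C.contactForce_of_lt i h] at hf
    obtain ⟨u, hu, rfl⟩ := hf
    exact hM u (by simpa using norm_le_one_of_mem_unitDir hu)
  · refine ⟨‖C.normalForce i‖, fun v f hf => ?_⟩
    rw [C.contactForce_of_not_lt i h, mem_singleton_iff] at hf
    rw [hf]

/-- The set whose convex hull is the net force set. -/
def activeForce (v : Velocity n) : Set (Velocity n) :=
  {f | ∃ i, v ∈ closure (C.contactActiveSet i) ∧ f ∈ C.contactForce i v}

theorem isCompact_activeForce (v : Velocity n) : IsCompact (C.activeForce v) := by
  have : C.activeForce v =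
      ⋃ i ∈ {i | v ∈ closure (C.contactActiveSet i)}, C.contactForce i v := by
    ext f; simp [activeForce]
  rw [this]
  exact (toFinite _).isCompact_biUnion fun i _ => C.isCompact_contactForce i v

/-- Taking closures of the active sets matters here: a contact that contributes nothing at `v`
contributes nothing nearby. -/
theorem eventually_activeForce_subset {v : Velocity n} {U : Set (Velocity n)}
    (hU : IsOpen U) (hv : C.activeForce v ⊆ U) : ∀ᶠ y in 𝓝 v, C.activeForce y ⊆ U := by
  have key : ∀ i, ∀ᶠ y in 𝓝 v, y ∈ closure (C.contactActiveSet i) → C.contactForce i y ⊆ U := by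
    intro i
    by_cases hi : v ∈ closure (C.contactActiveSet i)
    · filter_upwards [C.eventually_contactForce_subset i hU fun f hf => hv ⟨i, hi, hf⟩] with y hy _
      exact hy
    · filter_upwards [isClosed_closure.isOpen_compl.mem_nhds hi] with y hy hy'
      exact absurd hy' hy
  filter_upwards [eventually_all.2 key] with y hy
  rintro f ⟨i, hi, hf⟩
  exact hy i hi hf

theorem isOpen_activeSet : IsOpen C.activeSet := by
  have : C.activeSet = ⋃ i, {v | C.normalVel i v < 0} := by ext; simp [activeSet]
  rw [this]
  exact isOpen_iUnion fun i => isOpen_lt (C.continuous_normalVel i) continuous_const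

theorem notMem_activeSet_of_mem_inactiveSet {v : Velocity n} (hv : v ∈ C.inactiveSet) :
    v ∉ C.activeSet := interior_subset hv

/-- The derivative map is everywhere the convex hull of a compact nonempty set. -/
theorem exists_derivMap_eq_convexHull (v : Velocity n) :
    ∃ S : Set (Velocity n), IsCompact S ∧ S.Nonempty ∧ S ⊆ {0} ∪ C.activeForce v ∧
      C.derivMap v = convexHull ℝ S := by
  unfold derivMap
  split_ifs with h1 h2
  · exact ⟨{0}, isCompact_singleton, singleton_nonempty _, subset_union_left, by simp⟩
  · refine ⟨C.activeForce v, C.isCompact_activeForce v, ?_, subset_union_right, rfl⟩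
    obtain ⟨i, hi⟩ := h2
    obtain ⟨f, hf⟩ := C.contactForce_nonempty i v
    exact ⟨f, i, subset_closure hi, hf⟩
  · refine ⟨{0} ∪ C.activeForce v, isCompact_singleton.union (C.isCompact_activeForce v),
      ⟨0, Or.inl rfl⟩, Subset.rfl, ?_⟩
    apply Set.Subset.antisymm
    · exact convexHull_min (union_subset (subset_union_left.trans (subset_convexHull ℝ _))
        (convexHull_mono subset_union_right)) (convex_convexHull ℝ _)
    · exact convexHull_mono (union_subset_union_right _ (subset_convexHull ℝ _))

theorem convex_derivMap (v : Velocity n) : Convex ℝ (C.derivMap v) := by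
  obtain ⟨S, -, -, -, h⟩ := C.exists_derivMap_eq_convexHull v
  rw [h]; exact convex_convexHull ℝ S

theorem isClosed_derivMap (v : Velocity n) : IsClosed (C.derivMap v) := by
  obtain ⟨S, hS, -, -, h⟩ := C.exists_derivMap_eq_convexHull v
  rw [h]; exact (isCompact_convexHull_of_isCompact hS).isClosed

theorem derivMap_nonempty (v : Velocity n) : (C.derivMap v).Nonempty := by
  obtain ⟨S, -, hS, -, h⟩ := C.exists_derivMap_eq_convexHull v
  rw [h]; exact hS.convexHull

theorem exists_derivMap_bound : ∃ M : NNReal, ∀ v, ∀ w ∈ C.derivMap v, ‖w‖ ≤ M := by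
  choose B hB using C.exists_contactForce_bound
  refine ⟨∑ i, ‖B i‖₊, fun v w hw => ?_⟩
  obtain ⟨S, -, -, hS, h⟩ := C.exists_derivMap_eq_convexHull v
  rw [h] at hw
  have hsub : S ⊆ Metric.closedBall 0 (∑ i, ‖B i‖₊ : NNReal) := by
    intro f hf
    rw [mem_closedBall_zero_iff]
    rcases hS hf with h0 | ⟨i, -, hi⟩
    · rw [mem_singleton_iff] at h0
      rw [h0, norm_zero]; exact NNReal.coe_nonneg _
    · refine (hB i v f hi).trans ((le_abs_self _).trans ?_)
      push_cast
      exact Finset.single_le_sum (f := fun i => ‖B i‖) (fun _ _ => norm_nonneg _)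
        (Finset.mem_univ i)
  simpa using convexHull_min hsub (convex_closedBall _ _) hw

/-- The inactive and active sets are open, so on each a single branch persists nearby. At the
remaining points `0` already belongs to the value, so switching to any branch nearby is harmless. -/
theorem halfSpaceUSC_derivMap : HalfSpaceUSC C.derivMap := by
  intro v f c hv
  have hopen : IsOpen {w : Velocity n | f w < c} := isOpen_lt f.continuous continuous_const
  have hcvx : Convex ℝ {w : Velocity n | f w < c} :=
    (convex_Iio c).is_linear_preimage f.toLinearMap.isLinear
  by_cases h1 : v ∈ C.inactiveSet
  · filter_upwards [isOpen_interior.mem_nhds h1] with y hy w hw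
    refine hv w ?_
    have hy' : y ∈ C.inactiveSet := hy
    rw [derivMap, if_pos hy'] at hw
    rwa [derivMap, if_pos h1]
  by_cases h2 : v ∈ C.activeSet
  · have hsub : C.activeForce v ⊆ {w | f w < c} := fun w hw => hv w (by
      rw [derivMap, if_neg h1, if_pos h2]; exact subset_convexHull ℝ _ hw)
    filter_upwards [C.isOpen_activeSet.mem_nhds h2, C.eventually_activeForce_subset hopen hsub]
      with y hy hyU w hw
    rw [derivMap, if_neg fun h => C.notMem_activeSet_of_mem_inactiveSet h hy, if_pos hy] at hw
    exact convexHull_min hyU hcvx hw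
  · have hD : {0} ∪ C.netForce v ⊆ {w | f w < c} := fun w hw => hv w (by
      rw [derivMap, if_neg h1, if_neg h2]; exact subset_convexHull ℝ _ hw)
    have hsub : C.activeForce v ⊆ {w | f w < c} := fun w hw =>
      hD (Or.inr (subset_convexHull ℝ _ hw))
    filter_upwards [C.eventually_activeForce_subset hopen hsub] with y hy w hw
    obtain ⟨S, -, -, hS, h⟩ := C.exists_derivMap_eq_convexHull y
    rw [h] at hw
    exact convexHull_min (hS.trans (union_subset (subset_union_left.trans hD) hy)) hcvx hw

end ContactSet

end MultiContact

theorem mainTheorem10 {n m k : ℕ} (C : MultiContact.ContactSet n m k)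
    (v₀ : MultiContact.Velocity n) (a b : ℝ) (hab : a ≤ b) :
    (MultiContact.solutionSet C.derivMap a b).Nonempty ∧
    MultiContact.ClosedUnderUniformConvergence (MultiContact.solutionSet C.derivMap a b) a b ∧
    (MultiContact.ivpSet C.derivMap v₀ a b).Nonempty ∧
    MultiContact.ClosedUnderUniformConvergence (MultiContact.ivpSet C.derivMap v₀ a b) a b := by
  obtain ⟨M, hM⟩ := C.exists_derivMap_bound
  have hclosed := MultiContact.closedUnderUniformConvergence_solutionSet C.halfSpaceUSC_derivMap
    C.convex_derivMap C.isClosed_derivMap hM hab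
  have hne := MultiContact.ivpSet_nonempty C.halfSpaceUSC_derivMap C.convex_derivMap
    C.isClosed_derivMap C.derivMap_nonempty hM v₀ hab
  refine ⟨hne.mono fun v hv => hv.1, hclosed, hne, fun u v hu huv =>
    ⟨hclosed u v (fun j => (hu j).1) huv, ?_⟩⟩
  -- The initial value passes to the limit by convergence at `a`.
  refine tendsto_nhds_unique (huv.tendsto_at (Set.left_mem_Icc.2 hab)) ?_
  simp only [(hu _).2]
  exact tendsto_const_nhds
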